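/- For $\eta>0$, $\theta\in[-\pi,\pi]$, $\varphi\in(-\pi,\pi]$ let $x=(x_0,x_1,x_2)\in\mathbb R^3$ be the point with toroidal coordinates $(\eta,\theta,\varphi)$, $$x_0=\frac{\sin\theta}{\cosh\eta-\cos\theta},\quad x_1=\frac{\sinh\eta\cos\varphi}{\cosh\eta-\cos\theta},\quad x_2=\frac{\sinh\eta\sin\varphi}{\cosh\eta-\cos\theta},$$ and for $\eta_0>0$ let $\Omega_{\eta_0}=\{x:\eta>\eta_0\}\cup\{x: x_0=0,\ x_1^2+x_2^2=1\}$ be the corresponding open solid torus. For $t>1$, real $\nu>-1$ and integer $m\ge0$ let $$Q_\nu^m(t)=\frac{(-1)^m}{2^{\nu+1}}\frac{\Gamma(\nu+m+1)}{\Gamma(\nu+1)}(t^2-1)^{m/2}\int_{-1}^1\frac{(1-s^2)^\nu}{(t-s)^{\nu+m+1}}\,ds .$$ For integers $n,m\ge0$ and a sign $\pm$ let $$I_{n,m}^{+,\pm}(x)=\sqrt{\cosh\eta-\cos\theta}\;Q_{n-1/2}^m(\cosh\eta)\,\cos(n\theta)\,\Phi_m^{\pm}(\varphi),\qquad \Phi_m^+(\varphi)=\cos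 m\varphi,\quad \Phi_m^-(\varphi)=\sin m\varphi,$$ extended by continuity to the circle $\{x_0=0,\ x_1^2+x_2^2=1\}$. For $m\in\mathbb Z$ let $J_m^+(x)=\operatorname{Re}(x_1+ix_2)^m$ and $J_m^-(x)=\operatorname{Im}(x_1+ix_2)^m$. Proposition. For all $m\in\mathbb Z$, each sign $\pm$, and every $\eta_0>0$, $$J_m^\pm=\sum_{n=0}^\infty j_{n,m}\,I_{n,|m|}^{+,\pm}\quad\text{on }\Omega_{\eta_0},$$ the series converging unconditionally and uniformly on $\Omega_{\eta_0}$ (hence also pointwise and in $L^2(\Omega_{\eta_0})$), where $$j_{n,m}=\begin{cases}\displaystyle(2-\delta_{0,n})(-1)^m\sqrt{\frac2\pi}\,\frac1{\Gamma(m+\frac12)},& m\ge0,\\[2ex]\displaystyle\pm(2-\delta_{0,n})(-1)^m\sqrt{\frac2\pi}\,\frac1{\Gamma(m+\frac12)}\,\frac{\Gamma(n+m+\frac12)}{\Gamma(n-m+\frac12)},& m<0,\end{cases}$$ $\delta_{0,n}$ is the Kronecker delta, and the sign $\pm$ in the case $m<0$ is that of $J_m^\pm$. -/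

import Mathlib

open Filter Topology

noncomputable section

namespace Toroidal

/-- The point of `ℝ³` with toroidal coordinates `(η, θ, φ)`. -/
def point (η θ φ : ℝ) : EuclideanSpace ℝ (Fin 3) :=
  !₂[Real.sin θ / (Real.cosh η - Real.cos θ),
     Real.sinh η * Real.cos φ / (Real.cosh η - Real.cos θ),
     Real.sinh η * Real.sin φ / (Real.cosh η - Real.cos θ)]

/-- The limiting circle `η = ∞`. -/
def limitCircle : Set (EuclideanSpace ℝ (Fin 3)) :=
  {x | x 0 = 0 ∧ x 1 ^ 2 + x 2 ^ 2 = 1}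

/-- The open solid torus `{η > η₀} ∪ {η = ∞}`. -/
def solidTorus (η₀ : ℝ) : Set (EuclideanSpace ℝ (Fin 3)) :=
  {x | ∃ η θ φ : ℝ, 0 < η ∧ η₀ < η ∧ θ ∈ Set.Icc (-Real.pi) Real.pi ∧
    φ ∈ Set.Ioc (-Real.pi) Real.pi ∧ x = point η θ φ} ∪ limitCircle

/-- The coordinate `η` as a function of the point: `tanh η = 2 ρ / (|x|² + 1)`, where `ρ` is the
distance from `x` to the `x₀`-axis (see `eta_point`). -/
def eta (x : EuclideanSpace ℝ (Fin 3)) : ℝ :=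
  Real.artanh (2 * √(x 1 ^ 2 + x 2 ^ 2) / (x 0 ^ 2 + x 1 ^ 2 + x 2 ^ 2 + 1))

/-- The coordinate `θ` in `(-π, π]` as a function of the point (see `theta_point`). -/
def theta (x : EuclideanSpace ℝ (Fin 3)) : ℝ :=
  Complex.arg ⟨x 0 ^ 2 + x 1 ^ 2 + x 2 ^ 2 - 1, 2 * x 0⟩

/-- The coordinate `φ` in `(-π, π]` as a function of the point (see `phi_point`). -/
def phi (x : EuclideanSpace ℝ (Fin 3)) : ℝ :=
  Complex.arg ⟨x 1, x 2⟩

theorem denom_pos {η : ℝ} (hη : 0 < η) (θ : ℝ) : 0 < Real.cosh η - Real.cos θ := by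
  have h1 := Real.one_lt_cosh.2 hη.ne'
  have h2 := Real.cos_le_one θ
  linarith

theorem normSq_point {η : ℝ} (hη : 0 < η) (θ φ : ℝ) :
    point η θ φ 0 ^ 2 + point η θ φ 1 ^ 2 + point η θ φ 2 ^ 2 =
      (Real.cosh η + Real.cos θ) / (Real.cosh η - Real.cos θ) := by
  have hd := (denom_pos hη θ).ne'
  have h1 := Real.cosh_sq η
  have h2 := Real.sin_sq_add_cos_sq θ
  have h3 := Real.sin_sq_add_cos_sq φ
  simp only [point, PiLp.toLp_apply, Matrix.cons_val]
  field_simp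
  linear_combination Real.sinh η ^ 2 * h3 + h2 - h1

theorem eta_point {η : ℝ} (hη : 0 < η) (θ φ : ℝ) : eta (point η θ φ) = η := by
  have hd := denom_pos hη θ
  have hs := Real.sinh_pos_iff.2 hη
  have hc := Real.cosh_pos η
  have h3 := Real.sin_sq_add_cos_sq φ
  have hρ : √(point η θ φ 1 ^ 2 + point η θ φ 2 ^ 2) =
      Real.sinh η / (Real.cosh η - Real.cos θ) := by
    rw [Real.sqrt_eq_iff_mul_self_eq (by positivity) (by positivity)]
    simp only [point, PiLp.toLp_apply, Matrix.cons_val]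
    field_simp
    linear_combination h3
  rw [eta, hρ, normSq_point hη]
  have : 2 * (Real.sinh η / (Real.cosh η - Real.cos θ)) /
      ((Real.cosh η + Real.cos θ) / (Real.cosh η - Real.cos θ) + 1) = Real.tanh η := by
    rw [Real.tanh_eq_sinh_div_cosh]
    have : (Real.cosh η + Real.cos θ) / (Real.cosh η - Real.cos θ) + 1 =
      2 * Real.cosh η / (Real.cosh η - Real.cos θ) := by field_simp; ring
    rw [this]
    field_simp
  rw [this, Real.artanh_tanh]

theorem arg_polar {r α : ℝ} (hr : 0 < r) (hα : α ∈ Set.Ioc (-Real.pi) Real.pi) :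
    Complex.arg ⟨r * Real.cos α, r * Real.sin α⟩ = α := by
  have h : (⟨r * Real.cos α, r * Real.sin α⟩ : ℂ) =
      (r : ℂ) * (Complex.cos (α : ℂ) + Complex.sin (α : ℂ) * Complex.I) := by
    rw [← Complex.ofReal_cos, ← Complex.ofReal_sin]
    apply Complex.ext <;>
      simp only [Complex.re_ofReal_mul, Complex.im_ofReal_mul, Complex.add_re, Complex.add_im,
        Complex.ofReal_re, Complex.ofReal_im, Complex.mul_I_re, Complex.mul_I_im] <;> ring
  rw [h, Complex.arg_mul_cos_add_sin_mul_I hr hα]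

theorem theta_point {η θ : ℝ} (hη : 0 < η) (hθ : θ ∈ Set.Ioc (-Real.pi) Real.pi) (φ : ℝ) :
    theta (point η θ φ) = θ := by
  have hd := denom_pos hη θ
  have h1 : (Real.cosh η + Real.cos θ) / (Real.cosh η - Real.cos θ) - 1 =
      2 / (Real.cosh η - Real.cos θ) * Real.cos θ := by
    field_simp
    ring
  have h2 : 2 * point η θ φ 0 = 2 / (Real.cosh η - Real.cos θ) * Real.sin θ := by
    simp only [point, PiLp.toLp_apply, Matrix.cons_val]
    ring
  rw [theta, normSq_point hη, h1, h2, arg_polar (by positivity) hθ]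

theorem phi_point {η φ : ℝ} (hη : 0 < η) (θ : ℝ) (hφ : φ ∈ Set.Ioc (-Real.pi) Real.pi) :
    phi (point η θ φ) = φ := by
  have hd := denom_pos hη θ
  have hs := Real.sinh_pos_iff.2 hη
  have h1 : point η θ φ 1 = Real.sinh η / (Real.cosh η - Real.cos θ) * Real.cos φ := by
    simp only [point, PiLp.toLp_apply, Matrix.cons_val]
    ring
  have h2 : point η θ φ 2 = Real.sinh η / (Real.cosh η - Real.cos θ) * Real.sin φ := by
    simp only [point, PiLp.toLp_apply, Matrix.cons_val]
    ring
  rw [phi, h1, h2, arg_polar (by positivity) hφ]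

/-- The associated Legendre function of the second kind `Q_ν^m(t)`, for `t > 1`, real degree
`ν > -1` and order `m = 0, 1, 2, …`, with `(ν + m)! / ν! = Γ(ν + m + 1) / Γ(ν + 1)`. -/
def legendreQ (ν : ℝ) (m : ℕ) (t : ℝ) : ℝ :=
  (-1) ^ m / 2 ^ (ν + 1) * (Real.Gamma (ν + m + 1) / Real.Gamma (ν + 1)) *
    (t ^ 2 - 1) ^ ((m : ℝ) / 2) *
    ∫ s in (-1 : ℝ)..1, (1 - s ^ 2) ^ ν / (t - s) ^ (ν + m + 1)

/-- `Φ_n^+(θ) = cos nθ` and `Φ_n^-(θ) = sin nθ`; signs are elements of `ℤˣ = {1, -1}`. -/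
def trig (n : ℕ) (ν : ℤˣ) (θ : ℝ) : ℝ :=
  if ν = 1 then Real.cos (n * θ) else Real.sin (n * θ)

/-- The expression defining the interior toroidal harmonics off the limiting circle. -/
def interiorFormula (n m : ℕ) (ν μ : ℤˣ) (x : EuclideanSpace ℝ (Fin 3)) : ℝ :=
  √(Real.cosh (eta x) - Real.cos (theta x)) *
    legendreQ ((n : ℝ) - 1 / 2) m (Real.cosh (eta x)) *
    trig n ν (theta x) * trig m μ (phi x)

open Classical in
/-- The interior toroidal harmonics `I_{n,m}^{ν,μ}`. On the limiting circle `η = ∞`, where toroidal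
coordinates are not defined, the value is the limit from points off the circle. -/
def interiorHarmonic (n m : ℕ) (ν μ : ℤˣ) (x : EuclideanSpace ℝ (Fin 3)) : ℝ :=
  if x ∈ limitCircle then limUnder (𝓝[limitCircleᶜ] x) (interiorFormula n m ν μ)
  else interiorFormula n m ν μ x

/-- `J_m^+(x) = Re (x₁ + i x₂)^m` and `J_m^-(x) = Im (x₁ + i x₂)^m`. -/
def powerHarmonic (m : ℤ) (μ : ℤˣ) (x : EuclideanSpace ℝ (Fin 3)) : ℝ :=
  if μ = 1 then (((x 1 : ℂ) + (x 2 : ℂ) * Complex.I) ^ m).re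
  else (((x 1 : ℂ) + (x 2 : ℂ) * Complex.I) ^ m).im

/-- The coefficients `j_{n,m}` in the expansion of `J_m^μ`; for `m < 0` they carry the sign `μ`.
The factor `2 - δ_{0,n}` is the Neumann factor. -/
def coeffJ (n : ℕ) (m : ℤ) (μ : ℤˣ) : ℝ :=
  if 0 ≤ m then
    (if n = 0 then (1 : ℝ) else 2) * (-1) ^ m * √(2 / Real.pi) * (1 / Real.Gamma ((m : ℝ) + 1 / 2))
  else
    ((μ : ℤ) : ℝ) * (if n = 0 then (1 : ℝ) else 2) * (-1) ^ m * √(2 / Real.pi) *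
      (1 / Real.Gamma ((m : ℝ) + 1 / 2)) *
      (Real.Gamma ((n : ℝ) + m + 1 / 2) / Real.Gamma ((n : ℝ) - m + 1 / 2))

end Toroidal

end

noncomputable section

namespace Toroidal

open Real MeasureTheory

/-! With `t = cosh η`, off the limiting circle `x₁ + i x₂ = (sinh η / (t - cos θ)) e^{iφ}`. Hence
`J_m` is, up to sign, a trigonometric function of `|m|φ` times `√(t - cos θ) · sinh^m η · (t - cos
θ)^(-m-1/2)`. The expansion is therefore the Fourier cosine series of `(t - cos θ)^(-m-1/2)`.

Its coefficients are Legendre functions. Jacobi's formula (`cosIntegral_eq_sinIntegral`) trades `cos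
nθ` for `sin^(2n) θ`, and `s = cos θ` turns the result into the integral defining `Q_{n-1/2}`. For
`m < 0` an involution of `[-1, 1]` replaces order `m` by `|m|` (`kernelIntegral_reflect`). The Gamma
factors then match `j_{n,m}` (`coeffJ_mul_legendreQ`).

For uniform convergence the coefficients are multiplied by `√(t - cos θ) sinh^m η`. The resulting
integrand is bounded above and below by powers of `coth(η/2)`, and two integrations by parts give a
bound `C / (n² + 1)` uniform in `η ≥ η₀` and in `θ`. The M-test then gives convergence along the net
of finite sets, which is the unconditional statement.

On the limiting circle `coth(η/2) → 1`, so every term with `n ≠ 0` tends to zero and the term `n =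
0` alone gives `J_m`. -/

/-- `∫_0^π cos(nθ) (t - cos θ)^(-a) dθ`. -/
def cosIntegral (t a : ℝ) (n : ℤ) : ℝ :=
  ∫ θ in (0 : ℝ)..π, cos (n * θ) * (t - cos θ) ^ (-a)

/-- `∫_0^π sin^(2n) θ (t - cos θ)^(-b) dθ`. -/
def sinIntegral (t b : ℝ) (n : ℕ) : ℝ :=
  ∫ θ in (0 : ℝ)..π, sin θ ^ (2 * n) * (t - cos θ) ^ (-b)

/-! ### Recurrences by integration by parts, and Jacobi's formula -/

theorem sub_cos_pos {t : ℝ} (ht : 1 < t) (θ : ℝ) : 0 < t - cos θ := by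
  linarith [cos_le_one θ]

theorem continuous_sub_cos_rpow {t : ℝ} (ht : 1 < t) (p : ℝ) :
    Continuous fun θ => (t - cos θ) ^ p :=
  (continuous_const.sub continuous_cos).rpow_const fun θ => .inl (sub_cos_pos ht θ).ne'

theorem hasDerivAt_sub_cos_rpow {t : ℝ} (ht : 1 < t) (p θ : ℝ) :
    HasDerivAt (fun θ => (t - cos θ) ^ p) (sin θ * p * (t - cos θ) ^ (p - 1)) θ := by
  have h : HasDerivAt (fun θ => t - cos θ) (sin θ) θ := by
    simpa using (hasDerivAt_cos θ).const_sub t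
  exact h.rpow_const (.inl (sub_cos_pos ht θ).ne')

theorem intervalIntegrable_cosIntegral {t : ℝ} (ht : 1 < t) (a : ℝ) (n : ℤ) (x y : ℝ) :
    IntervalIntegrable (fun θ => cos (n * θ) * (t - cos θ) ^ (-a)) volume x y :=
  ((by fun_prop : Continuous fun θ : ℝ => cos (n * θ)).mul
    (continuous_sub_cos_rpow ht _)).intervalIntegrable _ _

theorem intervalIntegrable_sinIntegral {t : ℝ} (ht : 1 < t) (b : ℝ) (n : ℕ) (x y : ℝ) :
    IntervalIntegrable (fun θ => sin θ ^ (2 * n) * (t - cos θ) ^ (-b)) volume x y :=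
  ((by fun_prop : Continuous fun θ : ℝ => sin θ ^ (2 * n)).mul
    (continuous_sub_cos_rpow ht _)).intervalIntegrable _ _

/-- Integration by parts: `sin(nθ) (t - cos θ)^(-a)` vanishes at both ends, and `2 sin nθ sin θ` is
a difference of cosines. Used both for Jacobi's formula and for the decay in `n`. -/
theorem mul_cosIntegral {t : ℝ} (ht : 1 < t) (a : ℝ) (n : ℤ) :
    n * cosIntegral t a n =
      a / 2 * (cosIntegral t (a + 1) (n - 1) - cosIntegral t (a + 1) (n + 1)) := by
  have hd : ∀ θ ∈ Set.uIcc 0 π, HasDerivAt (fun θ => sin (n * θ) * (t - cos θ) ^ (-a))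
      (n * (cos (n * θ) * (t - cos θ) ^ (-a)) -
        a / 2 * (cos ((n - 1 : ℤ) * θ) * (t - cos θ) ^ (-(a + 1)) -
          cos ((n + 1 : ℤ) * θ) * (t - cos θ) ^ (-(a + 1)))) θ := by
    intro θ _
    have h1 : HasDerivAt (fun θ : ℝ => sin (n * θ)) (cos (n * θ) * n) θ := by
      simpa using ((hasDerivAt_id θ).const_mul (n : ℝ)).sin
    refine (h1.mul (hasDerivAt_sub_cos_rpow ht (-a) θ)).congr_deriv ?_
    have h2 : ((n - 1 : ℤ) : ℝ) * θ = n * θ - θ := by push_cast; ring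
    have h3 : ((n + 1 : ℤ) : ℝ) * θ = n * θ + θ := by push_cast; ring
    rw [h2, h3, cos_sub, cos_add, show -(a + 1) = -a - 1 by ring]
    ring
  have hi := intervalIntegrable_cosIntegral ht (x := 0) (y := π)
  have h := intervalIntegral.integral_eq_sub_of_hasDerivAt hd
    (((hi a n).const_mul _).sub
      (((hi (a + 1) (n - 1)).sub (hi (a + 1) (n + 1))).const_mul _))
  rw [intervalIntegral.integral_sub ((hi a n).const_mul _)
      (((hi (a + 1) (n - 1)).sub (hi (a + 1) (n + 1))).const_mul _),
    intervalIntegral.integral_const_mul, intervalIntegral.integral_const_mul,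
    intervalIntegral.integral_sub (hi (a + 1) (n - 1)) (hi (a + 1) (n + 1)),
    sin_int_mul_pi] at h
  simp only [mul_zero, sin_zero, zero_mul, sub_zero] at h
  unfold cosIntegral
  linarith

theorem cosIntegral_zero (t a : ℝ) : cosIntegral t a 0 = sinIntegral t a 0 := by
  simp [cosIntegral, sinIntegral]

theorem cosIntegral_neg (t a : ℝ) (n : ℤ) : cosIntegral t a (-n) = cosIntegral t a n := by
  simp [cosIntegral]

theorem cosIntegral_one {t : ℝ} (ht : 1 < t) (a : ℝ) :
    cosIntegral t a 1 = a * sinIntegral t (a + 1) 1 := by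
  have hd : ∀ θ ∈ Set.uIcc 0 π, HasDerivAt (fun θ => sin θ * (t - cos θ) ^ (-a))
      (cos ((1 : ℤ) * θ) * (t - cos θ) ^ (-a) -
        a * (sin θ ^ (2 * 1) * (t - cos θ) ^ (-(a + 1)))) θ := by
    intro θ _
    refine ((hasDerivAt_sin θ).mul (hasDerivAt_sub_cos_rpow ht (-a) θ)).congr_deriv ?_
    rw [show -(a + 1) = -a - 1 by ring, Int.cast_one, one_mul]
    ring
  have hi := intervalIntegrable_cosIntegral ht a 1 0 π
  have hj := (intervalIntegrable_sinIntegral ht (a + 1) 1 0 π).const_mul a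
  have h := intervalIntegral.integral_eq_sub_of_hasDerivAt hd (hi.sub hj)
  rw [intervalIntegral.integral_sub hi hj, intervalIntegral.integral_const_mul] at h
  simp only [sin_pi, sin_zero, zero_mul, sub_zero] at h
  unfold cosIntegral sinIntegral
  linarith

/-- The primitive merges two integrations by parts, so that the mixed terms `sin^(2n+2) θ cos θ (t -
cos θ)^(-b-1)` cancel; `cos² = 1 - sin²` does the rest. -/
theorem sinIntegral_recurrence {t : ℝ} (ht : 1 < t) (b : ℝ) (n : ℕ) :
    b * (b + 1) * sinIntegral t (b + 2) (n + 2) =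
      (2 * n + 3) * ((2 * n + 1) * sinIntegral t b n - (2 * n + 2) * sinIntegral t b (n + 1)) := by
  have hd : ∀ θ ∈ Set.uIcc 0 π, HasDerivAt (fun θ =>
      b * (sin θ ^ (2 * n + 3) * (t - cos θ) ^ (-b - 1)) +
        (2 * n + 3) * (sin θ ^ (2 * n + 1) * cos θ * (t - cos θ) ^ (-b)))
      ((2 * n + 3) * (2 * n + 1) * (sin θ ^ (2 * n) * (t - cos θ) ^ (-b)) -
        (2 * n + 3) * (2 * n + 2) * (sin θ ^ (2 * (n + 1)) * (t - cos θ) ^ (-b)) -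
        b * (b + 1) * (sin θ ^ (2 * (n + 2)) * (t - cos θ) ^ (-(b + 2)))) θ := by
    intro θ _
    have h1 := (((hasDerivAt_sin θ).pow (2 * n + 3)).mul
      (hasDerivAt_sub_cos_rpow ht (-b - 1) θ)).const_mul b
    have h2 := ((((hasDerivAt_sin θ).pow (2 * n + 1)).mul (hasDerivAt_cos θ)).mul
      (hasDerivAt_sub_cos_rpow ht (-b) θ)).const_mul (2 * (n : ℝ) + 3)
    refine (h1.add h2).congr_deriv ?_
    rw [show -(b + 2) = -b - 1 - 1 by ring]
    simp only [Nat.add_sub_cancel, Pi.mul_apply, Pi.pow_apply,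
      show 2 * n + 3 - 1 = 2 * n + 2 by omega]
    push_cast
    have h3 := cos_sq' θ
    linear_combination ((2 * n + 3) * (2 * n + 1) * (sin θ ^ (2 * n) * (t - cos θ) ^ (-b))) * h3
  have i0 := (intervalIntegrable_sinIntegral ht b n 0 π).const_mul
    ((2 * (n : ℝ) + 3) * (2 * n + 1))
  have i1 := (intervalIntegrable_sinIntegral ht b (n + 1) 0 π).const_mul
    ((2 * (n : ℝ) + 3) * (2 * n + 2))
  have i2 := (intervalIntegrable_sinIntegral ht (b + 2) (n + 2) 0 π).const_mul (b * (b + 1))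
  have h := intervalIntegral.integral_eq_sub_of_hasDerivAt hd ((i0.sub i1).sub i2)
  rw [intervalIntegral.integral_sub (i0.sub i1) i2, intervalIntegral.integral_sub i0 i1,
    intervalIntegral.integral_const_mul, intervalIntegral.integral_const_mul,
    intervalIntegral.integral_const_mul] at h
  simp only [sin_pi, sin_zero, zero_mul, sub_zero, mul_zero, ne_eq, Nat.add_eq_zero_iff,
    OfNat.ofNat_ne_zero, one_ne_zero, and_false, not_false_eq_true, zero_pow, add_zero] at h
  unfold sinIntegral
  linarith

/-- Jacobi's formula, in the form of Gamma factors. -/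
theorem cosIntegral_eq_sinIntegral {t : ℝ} (ht : 1 < t) (n : ℕ) : ∀ a : ℝ, (∀ k : ℤ, a ≠ k) →
    cosIntegral t a n * (Gamma a * 2 ^ n * Gamma (n + 1 / 2)) =
      √π * Gamma (a + n) * sinIntegral t (a + n) n := by
  induction n using Nat.twoStepInduction with
  | zero =>
    intro a _
    rw [show (((0 : ℕ) : ℤ)) = 0 from rfl, cosIntegral_zero]
    simp only [pow_zero, Nat.cast_zero, zero_add, add_zero, Gamma_one_half_eq]
    ring
  | one =>
    intro a ha
    have ha0 : a ≠ 0 := by simpa using ha 0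
    rw [show (((1 : ℕ) : ℤ)) = 1 from rfl, cosIntegral_one ht]
    rw [Nat.cast_one, Gamma_add_one ha0, add_comm (1 : ℝ) (1 / 2), Gamma_add_one (by norm_num),
      Gamma_one_half_eq]
    ring
  | more n ih0 ih1 =>
    intro a ha
    have ha0 : a - 1 ≠ 0 := by
      have := ha 1
      rw [Int.cast_one] at this
      exact sub_ne_zero.2 this
    have hb : ∀ k : ℤ, a - 1 ≠ k := fun k h => ha (k + 1) (by push_cast; linarith)
    have hn0 : a + n ≠ 0 := fun h => ha (-n) (by push_cast; linarith)
    have hn1 : a + n + 1 ≠ 0 := fun h => ha (-n - 1) (by push_cast; linarith)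
    -- `r` expresses the cosine integral at `(a, n + 2)` through those at `(a, n)` and `(a - 1, n +
    -- 1)`. Both induction hypotheses then involve the same exponent `a + n = (a - 1) + (n + 1)`,
    -- which is what `s` needs. Since `a` shifts, the induction runs over all non-integral `a`; this
    -- also keeps `a - 1`, `a + n` and `a + n + 1` nonzero.
    have e0 := ih0 a ha
    have e1 := ih1 (a - 1) hb
    have r := mul_cosIntegral ht (a - 1) (n + 1)
    have s := sinIntegral_recurrence ht (a + n) n
    rw [show a - 1 + 1 = a by ring, show (n : ℤ) + 1 - 1 = n by ring,
      show (n : ℤ) + 1 + 1 = ((n + 2 : ℕ) : ℤ) by push_cast; ring] at r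
    rw [show a - 1 + ((n + 1 : ℕ) : ℝ) = a + n by push_cast; ring] at e1
    have g1 : Gamma (a + (n + 2 : ℕ)) = (a + n + 1) * ((a + n) * Gamma (a + n)) := by
      rw [← Gamma_add_one hn0, ← Gamma_add_one hn1]
      push_cast
      ring_nf
    have g2 : Gamma ((n + 1 : ℕ) + 1 / 2) = (n + 1 / 2) * Gamma (n + 1 / 2) := by
      rw [← Gamma_add_one (by positivity)]
      push_cast
      ring_nf
    have g3 : Gamma ((n + 2 : ℕ) + 1 / 2) = (n + 3 / 2) * ((n + 1 / 2) * Gamma (n + 1 / 2)) := by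
      rw [← Gamma_add_one (by positivity), show (n : ℝ) + 3 / 2 = n + 1 / 2 + 1 by ring,
        ← Gamma_add_one (by positivity)]
      push_cast
      ring_nf
    have g4 : Gamma a = (a - 1) * Gamma (a - 1) := by
      rw [← Gamma_add_one ha0]
      ring_nf
    rw [g2] at e1
    rw [g1, g3, show a + ((n + 2 : ℕ) : ℝ) = a + n + 2 by push_cast; ring]
    push_cast at r e1 ⊢
    rw [g4] at e0 ⊢
    have hG : √π * Gamma (a + n) * (a + n + 1) * (a + n) * sinIntegral t (a + n + 2) (n + 2) =
        √π * Gamma (a + n) * ((2 * n + 3) * ((2 * n + 1) * sinIntegral t (a + n) n -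
          (2 * n + 2) * sinIntegral t (a + n) (n + 1))) := by
      linear_combination √π * Gamma (a + n) * s
    rw [show n + 2 = n + 1 + 1 from rfl, pow_succ, pow_succ] at *
    linear_combination (2 * Gamma (a - 1) * 2 ^ n * 4 * (n + 3 / 2) * (n + 1 / 2) *
      Gamma (n + 1 / 2)) * r - hG + (2 * n + 3) * (2 * n + 1) * e0 -
      (2 * n + 3) * (2 * n + 2) * e1

/-! ### Identification of the cosine coefficients with Legendre functions -/

/-- `∫_{-1}^1 (1 - s²)^ν (t - s)^(-b) ds`, the integral in the definition of `legendreQ`. -/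
def kernelIntegral (t ν b : ℝ) : ℝ :=
  ∫ s in (-1 : ℝ)..1, (1 - s ^ 2) ^ ν / (t - s) ^ b

theorem sinIntegral_eq_kernelIntegral {t : ℝ} (ht : 1 < t) (b : ℝ) (n : ℕ) :
    sinIntegral t b n = kernelIntegral t (n - 1 / 2) b := by
  rw [sinIntegral, kernelIntegral, intervalIntegral.integral_of_le pi_pos.le,
    intervalIntegral.integral_of_le (by norm_num),
    ← integral_Icc_eq_integral_Ioc (x := (-1 : ℝ)), ← bijOn_cos.image_eq,
    integral_image_eq_integral_abs_deriv_smul measurableSet_Icc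
      (fun x _ => (hasDerivAt_cos x).hasDerivWithinAt) injOn_cos,
    integral_Icc_eq_integral_Ioo, integral_Ioc_eq_integral_Ioo]
  -- The endpoints are dropped because there `sin θ = 0`, and for `n = 0` the integrands disagree.
  refine setIntegral_congr_fun measurableSet_Ioo fun θ hθ => ?_
  have hs : 0 < sin θ := sin_pos_of_mem_Ioo hθ
  have e : |-sin θ| * (1 - cos θ ^ 2) ^ ((n : ℝ) - 1 / 2) = sin θ ^ (2 * n) := by
    rw [abs_neg, abs_of_pos hs, ← sin_sq, ← rpow_natCast (sin θ) 2, ← rpow_mul hs.le]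
    nth_rewrite 1 [← rpow_one (sin θ)]
    rw [← rpow_add hs, ← rpow_natCast]
    congr 1
    push_cast
    ring
  simp only [smul_eq_mul]
  rw [rpow_neg (sub_cos_pos ht θ).le, ← e]
  ring

/-- The involution `s = (1 - t u) / (t - u)` of `[-1, 1]` exchanges the orders `k` and `-k`. -/
theorem kernelIntegral_reflect {t : ℝ} (ht : 1 < t) (ν k : ℝ) :
    kernelIntegral t ν (ν + 1 - k) = (t ^ 2 - 1) ^ k * kernelIntegral t ν (ν + 1 + k) := by
  have hT : 0 < t ^ 2 - 1 := by nlinarith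
  have hpos : ∀ u ∈ Set.Icc (-1 : ℝ) 1, 0 < t - u := fun u hu => by linarith [hu.2]
  have hsub : ∀ u ∈ Set.Icc (-1 : ℝ) 1, t - (1 - t * u) / (t - u) = (t ^ 2 - 1) / (t - u) := by
    intro u hu
    have := (hpos u hu).ne'
    field_simp
    ring
  have hmaps : ∀ u ∈ Set.Icc (-1 : ℝ) 1, (1 - t * u) / (t - u) ∈ Set.Icc (-1 : ℝ) 1 := by
    intro u hu
    have := hpos u hu
    constructor
    · rw [le_div_iff₀ this]
      nlinarith [hu.1, hu.2]
    · rw [div_le_one this]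
      nlinarith [hu.1, hu.2]
  have hinv : ∀ u ∈ Set.Icc (-1 : ℝ) 1,
      (1 - t * ((1 - t * u) / (t - u))) / (t - (1 - t * u) / (t - u)) = u := by
    intro u hu
    have := (hpos u hu).ne'
    rw [hsub u hu]
    field_simp
    ring
  have himage : (fun u => (1 - t * u) / (t - u)) '' Set.Icc (-1 : ℝ) 1 = Set.Icc (-1 : ℝ) 1 :=
    Set.Subset.antisymm (Set.image_subset_iff.2 hmaps) fun u hu => ⟨_, hmaps u hu, hinv u hu⟩
  have hinj : Set.InjOn (fun u => (1 - t * u) / (t - u)) (Set.Icc (-1 : ℝ) 1) :=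
    Set.LeftInvOn.injOn (f₁' := fun u => (1 - t * u) / (t - u)) hinv
  have hderiv : ∀ u ∈ Set.Icc (-1 : ℝ) 1, HasDerivWithinAt (fun u => (1 - t * u) / (t - u))
      (-((t ^ 2 - 1) / (t - u) ^ 2)) (Set.Icc (-1 : ℝ) 1) u := by
    intro u hu
    have hne := (hpos u hu).ne'
    have h1 : HasDerivAt (fun u : ℝ => 1 - t * u) (-t) u := by
      simpa using ((hasDerivAt_id u).const_mul t).const_sub 1
    have h2 : HasDerivAt (fun u : ℝ => t - u) (-1) u := by
      simpa using (hasDerivAt_id u).const_sub t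
    refine ((h1.div h2 hne).congr_deriv ?_).hasDerivWithinAt
    field_simp
    ring
  rw [kernelIntegral, kernelIntegral, ← intervalIntegral.integral_const_mul,
    intervalIntegral.integral_of_le (by norm_num), intervalIntegral.integral_of_le (by norm_num),
    ← integral_Icc_eq_integral_Ioc, ← integral_Icc_eq_integral_Ioc]
  nth_rewrite 1 [← himage]
  rw [integral_image_eq_integral_abs_deriv_smul measurableSet_Icc hderiv hinj]
  refine setIntegral_congr_fun measurableSet_Icc fun u hu => ?_
  have hp := hpos u hu
  have hu2 : 0 ≤ 1 - u ^ 2 := by nlinarith [hu.1, hu.2]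
  have e1 : 1 - ((1 - t * u) / (t - u)) ^ 2 = (t ^ 2 - 1) * (1 - u ^ 2) / (t - u) ^ 2 := by
    field_simp
    ring
  simp only [smul_eq_mul]
  -- Each of `1 - s²`, `t - s` and `ds` is a power of `t² - 1` over a power of `t - u`, up to `1 -
  -- u²` and `du`. The exponents add up to `k` for `t² - 1` and to `-(ν + 1 + k)` for `t - u`.
  rw [hsub u hu, e1, abs_neg, abs_of_pos (by positivity), div_rpow (by positivity) (by positivity),
    mul_rpow hT.le hu2, div_rpow hT.le hp.le, ← rpow_natCast (t - u) 2, ← rpow_mul hp.le]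
  have a1 : (t ^ 2 - 1) ^ (ν + 1 - k) = (t ^ 2 - 1) ^ ν * (t ^ 2 - 1) / (t ^ 2 - 1) ^ k := by
    rw [rpow_sub hT, rpow_add hT, rpow_one]
  have a2 : (t - u) ^ (ν + 1 - k) = (t - u) ^ ν * (t - u) / (t - u) ^ k := by
    rw [rpow_sub hp, rpow_add hp, rpow_one]
  have a3 : (t - u) ^ (ν + 1 + k) = (t - u) ^ ν * (t - u) * (t - u) ^ k := by
    rw [rpow_add hp, rpow_add hp, rpow_one]
  have a4 : (t - u) ^ (((2 : ℕ) : ℝ) * ν) = (t - u) ^ ν * (t - u) ^ ν := by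
    rw [← rpow_add hp]
    push_cast
    ring_nf
  have b1 := rpow_pos_of_pos hT ν
  have b2 := rpow_pos_of_pos hT k
  have b3 := rpow_pos_of_pos hp ν
  have b4 := rpow_pos_of_pos hp k
  rw [a1, a2, a3, a4, Nat.cast_ofNat, rpow_two]
  field_simp

theorem add_half_ne_intCast (m k : ℤ) : (m : ℝ) + 1 / 2 ≠ k := by
  intro h
  have : ((2 * m + 1 : ℤ) : ℝ) = ((2 * k : ℤ) : ℝ) := by
    push_cast
    linarith
  have := Int.cast_injective this
  omega

theorem Gamma_add_half_ne_zero (m : ℤ) : Gamma ((m : ℝ) + 1 / 2) ≠ 0 :=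
  Gamma_ne_zero fun k h => add_half_ne_intCast m (-k) (by push_cast; exact h)

theorem kernelIntegral_eq_cosIntegral {t : ℝ} (ht : 1 < t) (m : ℤ) (n : ℕ) :
    kernelIntegral t (n - 1 / 2) (m + 1 / 2 + n) =
      Gamma (m + 1 / 2) * 2 ^ n * Gamma (n + 1 / 2) / (√π * Gamma (m + 1 / 2 + n)) *
        cosIntegral t (m + 1 / 2) n := by
  have h := cosIntegral_eq_sinIntegral ht n (m + 1 / 2) (add_half_ne_intCast m)
  rw [sinIntegral_eq_kernelIntegral ht] at h
  have h1 : Gamma ((m : ℝ) + 1 / 2 + n) ≠ 0 := by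
    have := Gamma_add_half_ne_zero (m + n)
    push_cast at this
    rwa [show (m : ℝ) + 1 / 2 + n = m + n + 1 / 2 by ring]
  have h2 : √π ≠ 0 := (sqrt_pos.2 pi_pos).ne'
  rw [div_mul_eq_mul_div, eq_div_iff (mul_ne_zero h2 h1)]
  linear_combination -h

theorem legendreQ_eq_kernelIntegral {η : ℝ} (hη : 0 < η) (n k : ℕ) :
    legendreQ ((n : ℝ) - 1 / 2) k (cosh η) =
      (-1) ^ k / (2 ^ n * √2) * (Gamma (k + 1 / 2 + n) / Gamma (n + 1 / 2)) *
        sinh η ^ k * kernelIntegral (cosh η) (n - 1 / 2) (k + 1 / 2 + n) := by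
  have hs := sinh_pos_iff.2 hη
  have e1 : (cosh η ^ 2 - 1) ^ ((k : ℝ) / 2) = sinh η ^ k := by
    rw [cosh_sq, add_sub_cancel_right, ← rpow_natCast (sinh η) 2, ← rpow_mul hs.le,
      ← rpow_natCast]
    congr 1
    push_cast
    ring
  have e2 : (2 : ℝ) ^ ((n : ℝ) - 1 / 2 + 1) = 2 ^ n * √2 := by
    rw [sqrt_eq_rpow, ← rpow_natCast, ← rpow_add two_pos]
    ring_nf
  rw [legendreQ, kernelIntegral, e1, e2, show (n : ℝ) - 1 / 2 + k + 1 = k + 1 / 2 + n by ring,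
    show (n : ℝ) - 1 / 2 + 1 = n + 1 / 2 by ring]

/-- The sign `μ` for `m < 0`, and `1` otherwise. -/
def coeffSign (m : ℤ) (μ : ℤˣ) : ℝ :=
  if 0 ≤ m then 1 else ((μ : ℤ) : ℝ)

/-- The constants `j_{n,m}` are exactly what cancels the Gamma factors of `Q` and of Jacobi's
formula, leaving a Fourier cosine coefficient. For `m = -k` the reflection contributes `sinh^(-2k)
η`, turning `sinh^k η` into `sinh^m η`. -/
theorem coeffJ_mul_legendreQ {η : ℝ} (hη : 0 < η) (n : ℕ) (m : ℤ) (μ : ℤˣ) :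
    coeffJ n m μ * legendreQ ((n : ℝ) - 1 / 2) m.natAbs (cosh η) =
      coeffSign m μ * ((if n = 0 then 1 else 2) / π) *
        (sinh η ^ m * cosIntegral (cosh η) (m + 1 / 2) n) := by
  have ht := one_lt_cosh.2 hη.ne'
  have hs := sinh_pos_iff.2 hη
  have g1 := Gamma_add_half_ne_zero m
  have g2 : Gamma ((n : ℝ) + 1 / 2) ≠ 0 := Gamma_add_half_ne_zero n
  have h2 : √(2 / π) = √2 / √π := sqrt_div (by norm_num) _
  have hπ : √π ≠ 0 := (sqrt_pos.2 pi_pos).ne'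
  have hπ2 : √π ^ 2 = π := sq_sqrt pi_pos.le
  have h22 : √(2 : ℝ) ≠ 0 := by positivity
  rw [legendreQ_eq_kernelIntegral hη]
  rcases le_or_gt 0 m with hm | hm
  · lift m to ℕ using hm
    have g3 : Gamma ((m : ℝ) + 1 / 2 + n) ≠ 0 := by positivity
    have hk := kernelIntegral_eq_cosIntegral ht m n
    rw [Int.cast_natCast] at hk g1
    have hsq : ((-1 : ℝ) ^ m) ^ 2 = 1 := by rw [← pow_mul, mul_comm, pow_mul]; norm_num
    have hm : (0 : ℤ) ≤ m := by positivity
    rw [Int.natAbs_natCast, hk, coeffJ, coeffSign, if_pos hm, if_pos hm, h2,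
      Int.cast_natCast, zpow_natCast, zpow_natCast]
    generalize (if n = 0 then (1 : ℝ) else 2) = ε
    generalize cosIntegral (cosh η) (m + 1 / 2) n = E at *
    generalize Gamma ((m : ℝ) + 1 / 2 + n) = G2 at *
    generalize Gamma ((m : ℝ) + 1 / 2) = G3 at *
    field_simp
    linear_combination ε * E * (π * hsq - hπ2)
  · obtain ⟨k, rfl⟩ : ∃ k : ℕ, m = -k := ⟨m.natAbs, by omega⟩
    have hr := kernelIntegral_reflect ht ((n : ℝ) - 1 / 2) k
    have hk := kernelIntegral_eq_cosIntegral ht (-k) n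
    push_cast at hk g1
    have g3 : Gamma (-(k : ℝ) + 1 / 2 + n) ≠ 0 := by
      have := Gamma_add_half_ne_zero (-k + n)
      push_cast at this
      rwa [show -(k : ℝ) + 1 / 2 + n = -k + n + 1 / 2 by ring]
    have g4 : Gamma ((k : ℝ) + 1 / 2 + n) ≠ 0 := by positivity
    rw [show (n : ℝ) - 1 / 2 + 1 - k = -k + 1 / 2 + n by ring, hk, cosh_sq,
      add_sub_cancel_right, rpow_natCast,
      show (n : ℝ) - 1 / 2 + 1 + k = k + 1 / 2 + n by ring] at hr
    have hr' : kernelIntegral (cosh η) (n - 1 / 2) (k + 1 / 2 + n) =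
        Gamma (-k + 1 / 2) * 2 ^ n * Gamma (n + 1 / 2) / (√π * Gamma (-k + 1 / 2 + n)) *
        cosIntegral (cosh η) (-k + 1 / 2) n / (sinh η ^ 2) ^ k :=
      (eq_div_iff (by positivity)).2 (by rw [hr]; ring)
    have hsq : ((-1 : ℝ) ^ k) ^ 2 = 1 := by rw [← pow_mul, mul_comm, pow_mul]; norm_num
    have hinv : ((-1 : ℝ) ^ k)⁻¹ = (-1) ^ k := by
      rw [← inv_pow]; norm_num
    rw [Int.natAbs_neg, Int.natAbs_natCast, hr', coeffJ, coeffSign, if_neg hm.not_ge,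
      if_neg hm.not_ge, h2, zpow_neg, zpow_neg, zpow_natCast, zpow_natCast, hinv]
    push_cast
    rw [show (n : ℝ) + -k + 1 / 2 = -k + 1 / 2 + n by ring,
      show (n : ℝ) - -k + 1 / 2 = k + 1 / 2 + n by ring]
    generalize (if n = 0 then (1 : ℝ) else 2) = ε
    rw [← pow_mul, show 2 * k = k + k by ring, pow_add]
    generalize cosIntegral (cosh η) (-k + 1 / 2) n = E at *
    generalize Gamma (-(k : ℝ) + 1 / 2 + n) = G1 at *
    generalize Gamma ((k : ℝ) + 1 / 2 + n) = G2 at *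
    generalize Gamma (-(k : ℝ) + 1 / 2) = G3 at *
    field_simp
    linear_combination ε * E * (π * hsq - hπ2)

/-- Needed on the limiting circle: the harmonic there is a limit taken without the coefficient,
while the computed limit includes it. -/
theorem coeffJ_ne_zero (n : ℕ) (m : ℤ) (μ : ℤˣ) : coeffJ n m μ ≠ 0 := by
  have h1 : √(2 / π) ≠ 0 := by positivity
  have h2 := Gamma_add_half_ne_zero m
  have h3 := Gamma_add_half_ne_zero (n + m)
  have h4 := Gamma_add_half_ne_zero (n - m)
  have h5 : ((-1 : ℝ)) ^ m ≠ 0 := zpow_ne_zero _ (by norm_num)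
  have h6 : (if n = 0 then (1 : ℝ) else 2) ≠ 0 := by split_ifs <;> norm_num
  have h7 : ((μ : ℤ) : ℝ) ≠ 0 := by exact_mod_cast μ.ne_zero
  push_cast at h3 h4
  rw [coeffJ]
  split_ifs <;> simp_all

/-! ### Bounds on the cosine coefficients, uniform in the torus -/

/-- `√((cosh η + 1) / (cosh η - 1))`. -/
def cothHalf (η : ℝ) : ℝ :=
  √((cosh η + 1) / (cosh η - 1))

theorem one_le_cothHalf {η : ℝ} (hη : 0 < η) : 1 ≤ cothHalf η := by
  have h := one_lt_cosh.2 hη.ne'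
  rw [cothHalf, one_le_sqrt, one_le_div (by linarith)]
  linarith

theorem cothHalf_le {η₀ η : ℝ} (hη₀ : 0 < η₀) (h : η₀ ≤ η) : cothHalf η ≤ cothHalf η₀ := by
  have h0 := one_lt_cosh.2 hη₀.ne'
  have h1 : cosh η₀ ≤ cosh η :=
    cosh_le_cosh.2 (by rwa [abs_of_pos hη₀, abs_of_pos (hη₀.trans_le h)])
  refine sqrt_le_sqrt ?_
  rw [div_le_div_iff₀ (by linarith) (by linarith)]
  linarith

theorem tendsto_cosh_atTop : Tendsto cosh atTop atTop := by
  refine tendsto_atTop_mono' _ ?_ tendsto_id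
  filter_upwards [eventually_ge_atTop 0] with x hx
  exact (self_le_sinh_iff.2 hx).trans (sinh_lt_cosh x).le

theorem tendsto_cothHalf : Tendsto cothHalf atTop (𝓝 1) := by
  have h1 : Tendsto (fun η => 1 + 2 / (cosh η - 1)) atTop (𝓝 (1 + 0)) :=
    tendsto_const_nhds.add (tendsto_const_nhds.div_atTop
      (tendsto_atTop_add_const_right _ (-1) tendsto_cosh_atTop))
  rw [add_zero] at h1
  have h2 := h1.sqrt
  rw [sqrt_one] at h2
  refine h2.congr' ?_
  filter_upwards [eventually_gt_atTop 0] with η hη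
  have := one_lt_cosh.2 hη.ne'
  have : cosh η - 1 ≠ 0 := by linarith
  rw [cothHalf]
  congr 1
  field_simp
  ring

theorem zpow_mem_Icc {r B : ℝ} (hB : 1 ≤ B) (h1 : B⁻¹ ≤ r) (h2 : r ≤ B) (m : ℤ) :
    (B ^ m.natAbs)⁻¹ ≤ r ^ m ∧ r ^ m ≤ B ^ m.natAbs := by
  have hB0 : 0 < B := by linarith
  have hr : 0 < r := (inv_pos.2 hB0).trans_le h1
  obtain ⟨k, rfl | rfl⟩ := m.eq_nat_or_neg
  · rw [Int.natAbs_natCast, zpow_natCast, ← inv_pow]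
    exact ⟨pow_le_pow_left₀ (by positivity) h1 _, pow_le_pow_left₀ hr.le h2 _⟩
  · rw [Int.natAbs_neg, Int.natAbs_natCast, zpow_neg, zpow_natCast]
    refine ⟨inv_anti₀ (by positivity) (pow_le_pow_left₀ hr.le h2 _), ?_⟩
    rw [← inv_pow]
    exact pow_le_pow_left₀ (by positivity) ((inv_le_comm₀ hB0 hr).1 h1) _

/-- The weight is `(sinh η / (cosh η - cos ψ))^m` times the square root of `(cosh η - cos θ) / (cosh
η - cos ψ)`. With `B = coth(η/2)`, the relations `B sinh η = cosh η + 1` and `B (cosh η - 1) = sinh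
η` put the base of the power and the square root in `[B⁻¹, B]`. -/
theorem weight_mem_Icc {η : ℝ} (hη : 0 < η) (θ ψ : ℝ) (m : ℤ) :
    √(cosh η - cos θ) * (sinh η ^ m * (cosh η - cos ψ) ^ (-((m : ℝ) + 1 / 2))) ∈
      Set.Icc ((cothHalf η ^ (m.natAbs + 1))⁻¹) (cothHalf η ^ (m.natAbs + 1)) := by
  have ht := one_lt_cosh.2 hη.ne'
  have hs := sinh_pos_iff.2 hη
  have hB := one_le_cothHalf hη
  have hB0 : 0 < cothHalf η := by linarith
  have hB2 : cothHalf η ^ 2 = (cosh η + 1) / (cosh η - 1) :=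
    sq_sqrt (div_nonneg (by linarith) (by linarith))
  have hθ := sub_cos_pos ht θ
  have hψ := sub_cos_pos ht ψ
  have ht1 : 0 < cosh η - 1 := by linarith
  have hsq : sinh η ^ 2 = (cosh η - 1) * (cosh η + 1) := by
    linarith [cosh_sq η]
  have hBs : cothHalf η * sinh η = cosh η + 1 := by
    rw [← sq_eq_sq₀ (by positivity) (by linarith), mul_pow, hB2, hsq]
    field_simp
  have hBt : cothHalf η * (cosh η - 1) = sinh η := by
    rw [← sq_eq_sq₀ (by positivity) (by linarith), mul_pow, hB2, hsq]
    field_simp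
  have c1 := cos_le_one ψ
  have c2 := neg_one_le_cos ψ
  have c3 := cos_le_one θ
  have c4 := neg_one_le_cos θ
  obtain ⟨r1, r2⟩ := zpow_mem_Icc (r := sinh η / (cosh η - cos ψ)) hB
    (by
      rw [inv_eq_one_div, div_le_div_iff₀ hB0 hψ]
      linarith)
    (by
      rw [div_le_iff₀ hψ]
      nlinarith) m
  have q1 : (cothHalf η)⁻¹ ≤ √((cosh η - cos θ) / (cosh η - cos ψ)) := by
    refine le_sqrt_of_sq_le ?_
    rw [inv_pow, hB2, inv_div]
    exact div_le_div₀ hθ.le (by linarith) hψ (by linarith)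
  have q2 : √((cosh η - cos θ) / (cosh η - cos ψ)) ≤ cothHalf η :=
    sqrt_le_sqrt (div_le_div₀ (by linarith) (by linarith) ht1 (by linarith))
  have e : √(cosh η - cos θ) * (sinh η ^ m * (cosh η - cos ψ) ^ (-((m : ℝ) + 1 / 2))) =
      (sinh η / (cosh η - cos ψ)) ^ m * √((cosh η - cos θ) / (cosh η - cos ψ)) := by
    rw [rpow_neg hψ.le, rpow_add hψ, rpow_intCast, ← sqrt_eq_rpow, div_zpow, sqrt_div hθ.le]
    ring
  rw [e, pow_succ, mul_inv]
  exact ⟨mul_le_mul r1 q1 (by positivity) (by positivity),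
    mul_le_mul r2 q2 (by positivity) (by positivity)⟩

/-- The Fourier cosine coefficient `E_n` of `(cosh η - cos ψ)^(-m-1/2)`, normalized so that it stays
bounded as `η → ∞`. -/
def normalizedCoeff (η θ : ℝ) (m n : ℤ) : ℝ :=
  √(cosh η - cos θ) * (sinh η ^ m * cosIntegral (cosh η) (m + 1 / 2) n)

theorem normalizedCoeff_eq_integral (η θ : ℝ) (m n : ℤ) :
    normalizedCoeff η θ m n = ∫ ψ in (0 : ℝ)..π, cos (n * ψ) *
      (√(cosh η - cos θ) * (sinh η ^ m * (cosh η - cos ψ) ^ (-((m : ℝ) + 1 / 2)))) := by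
  rw [normalizedCoeff, cosIntegral, ← mul_assoc, ← intervalIntegral.integral_const_mul]
  congr 1
  ext ψ
  ring

theorem abs_normalizedCoeff_le {η : ℝ} (hη : 0 < η) (θ : ℝ) (m n : ℤ) :
    |normalizedCoeff η θ m n| ≤ cothHalf η ^ (m.natAbs + 1) * π := by
  have hB0 : 0 < cothHalf η := by linarith [one_le_cothHalf hη]
  have h := intervalIntegral.norm_integral_le_of_norm_le_const (a := 0) (b := π)
    (f := fun ψ => cos (n * ψ) *
      (√(cosh η - cos θ) * (sinh η ^ m * (cosh η - cos ψ) ^ (-((m : ℝ) + 1 / 2)))))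
    (C := cothHalf η ^ (m.natAbs + 1)) fun ψ _ => by
      obtain ⟨h1, h2⟩ := weight_mem_Icc hη θ ψ m
      have h3 := (inv_pos.2 (pow_pos hB0 (m.natAbs + 1))).trans_le h1
      rw [norm_eq_abs, abs_mul, abs_of_pos h3]
      exact (mul_le_of_le_one_left h3.le (abs_cos_le_one _)).trans h2
  rwa [sub_zero, abs_of_pos pi_pos, norm_eq_abs, ← normalizedCoeff_eq_integral] at h

theorem normalizedCoeff_zero_ge {η : ℝ} (hη : 0 < η) (θ : ℝ) (m : ℤ) :
    (cothHalf η ^ (m.natAbs + 1))⁻¹ * π ≤ normalizedCoeff η θ m 0 := by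
  have ht := one_lt_cosh.2 hη.ne'
  rw [normalizedCoeff_eq_integral]
  have h := intervalIntegral.integral_mono_on (a := 0) (b := π) (μ := volume) pi_pos.le
    (f := fun _ => (cothHalf η ^ (m.natAbs + 1))⁻¹)
    (g := fun ψ => cos ((0 : ℤ) * ψ) *
      (√(cosh η - cos θ) * (sinh η ^ m * (cosh η - cos ψ) ^ (-((m : ℝ) + 1 / 2)))))
    intervalIntegrable_const
    (((by fun_prop : Continuous fun ψ : ℝ => cos ((0 : ℤ) * ψ)).mul
      (continuous_const.mul (continuous_const.mul
        (continuous_sub_cos_rpow ht _)))).intervalIntegrable _ _)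
    fun ψ _ => by simpa using! (weight_mem_Icc hη θ ψ m).1
  rwa [intervalIntegral.integral_const, smul_eq_mul, sub_zero, mul_comm π] at h

/-- Raising `m` by one absorbs a factor `sinh η`, so the integration by parts gains `1 / sinh η` as
well as `1 / n`. The first gain kills the terms `n ≠ 0` as `η → ∞`. -/
theorem mul_normalizedCoeff {η : ℝ} (hη : 0 < η) (θ : ℝ) (m n : ℤ) :
    n * normalizedCoeff η θ m n = (m + 1 / 2) / (2 * sinh η) *
      (normalizedCoeff η θ (m + 1) (n - 1) - normalizedCoeff η θ (m + 1) (n + 1)) := by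
  have hs := (sinh_pos_iff.2 hη).ne'
  have h := mul_cosIntegral (one_lt_cosh.2 hη.ne') (m + 1 / 2) n
  simp only [normalizedCoeff]
  rw [zpow_add_one₀ hs, Int.cast_add, Int.cast_one,
    show (m : ℝ) + 1 + 1 / 2 = m + 1 / 2 + 1 by ring]
  generalize cosIntegral (cosh η) ((m : ℝ) + 1 / 2 + 1) (n - 1) = x at *
  generalize cosIntegral (cosh η) ((m : ℝ) + 1 / 2 + 1) (n + 1) = y at *
  generalize cosIntegral (cosh η) ((m : ℝ) + 1 / 2) n = z at *
  have : (m + 1 / 2) / (2 * sinh η) * (√(cosh η - cos θ) * (sinh η ^ m * sinh η * x) -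
      √(cosh η - cos θ) * (sinh η ^ m * sinh η * y)) =
      √(cosh η - cos θ) * sinh η ^ m * ((m + 1 / 2) / 2 * (x - y)) := by
    field_simp
  rw [this, ← h]
  ring

theorem abs_mul_normalizedCoeff_le {η : ℝ} (hη : 0 < η) (θ : ℝ) (m n : ℤ) {A : ℝ}
    (h1 : |normalizedCoeff η θ (m + 1) (n - 1)| ≤ A)
    (h2 : |normalizedCoeff η θ (m + 1) (n + 1)| ≤ A) :
    |(n : ℝ)| * |normalizedCoeff η θ m n| ≤ |(m : ℝ) + 1 / 2| / sinh η * A := by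
  have hs := sinh_pos_iff.2 hη
  rw [← abs_mul, mul_normalizedCoeff hη, abs_mul, abs_div,
    abs_of_pos (by positivity : 0 < 2 * sinh η)]
  have := abs_sub (normalizedCoeff η θ (m + 1) (n - 1)) (normalizedCoeff η θ (m + 1) (n + 1))
  calc |(m : ℝ) + 1 / 2| / (2 * sinh η) * _ ≤ |(m : ℝ) + 1 / 2| / (2 * sinh η) * (A + A) := by
        gcongr
        linarith
    _ = _ := by
        field_simp
        ring

theorem exists_normalizedCoeff_bound {η₀ : ℝ} (hη₀ : 0 < η₀) (m : ℤ) : ∃ C : ℝ,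
    ∀ (η θ : ℝ) (n : ℤ), η₀ ≤ η → |normalizedCoeff η θ m n| ≤ C := by
  refine ⟨cothHalf η₀ ^ (m.natAbs + 1) * π, fun η θ n h =>
    (abs_normalizedCoeff_le (hη₀.trans_le h) θ m n).trans ?_⟩
  have := one_le_cothHalf (hη₀.trans_le h)
  have := cothHalf_le hη₀ h
  gcongr

theorem exists_mul_normalizedCoeff_bound {η₀ : ℝ} (hη₀ : 0 < η₀) (m : ℤ) : ∃ C : ℝ,
    ∀ (η θ : ℝ) (n : ℤ), η₀ ≤ η → |(n : ℝ)| * |normalizedCoeff η θ m n| ≤ C := by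
  obtain ⟨C, hC⟩ := exists_normalizedCoeff_bound hη₀ (m + 1)
  have hC0 : 0 ≤ C := (abs_nonneg _).trans (hC η₀ 0 0 le_rfl)
  refine ⟨|(m : ℝ) + 1 / 2| / sinh η₀ * C, fun η θ n h =>
    (abs_mul_normalizedCoeff_le (hη₀.trans_le h) θ m n (hC _ _ _ h) (hC _ _ _ h)).trans ?_⟩
  have := sinh_pos_iff.2 hη₀
  have := sinh_le_sinh.2 h
  gcongr

theorem exists_sq_normalizedCoeff_bound {η₀ : ℝ} (hη₀ : 0 < η₀) (m : ℤ) : ∃ C : ℝ,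
    ∀ (η θ : ℝ) (n : ℤ), η₀ ≤ η → |normalizedCoeff η θ m n| ≤ C * (1 / ((n : ℝ) ^ 2 + 1)) := by
  obtain ⟨A, hA⟩ := exists_normalizedCoeff_bound hη₀ m
  obtain ⟨D, hD⟩ := exists_mul_normalizedCoeff_bound hη₀ m
  obtain ⟨E, hE⟩ := exists_mul_normalizedCoeff_bound hη₀ (m + 1)
  -- The three summands bound the pieces of `n² + 1 = 1 + |n| + |n| (|n| - 1)`. The factor `|n| - 1`
  -- is the least possible size of the shifted indices `n ± 1`.
  refine ⟨A + D + |(m : ℝ) + 1 / 2| / sinh η₀ * E, fun η θ n h => ?_⟩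
  have hη := hη₀.trans_le h
  have hs₀ := sinh_pos_iff.2 hη₀
  have hs := sinh_le_sinh.2 h
  have hE0 : 0 ≤ E := (by positivity : (0 : ℝ) ≤ _).trans (hE η₀ 0 0 le_rfl)
  rw [mul_one_div, le_div_iff₀ (by positivity)]
  have h0 := hA η θ n h
  have h1 := hD η θ n h
  have h2 : (|(n : ℝ)| - 1) * (|(n : ℝ)| * |normalizedCoeff η θ m n|) ≤
      |(m : ℝ) + 1 / 2| / sinh η₀ * E := by
    rcases le_or_gt (|(n : ℝ)|) 1 with hn | hn
    · exact (mul_nonpos_of_nonpos_of_nonneg (by linarith) (by positivity)).trans (by positivity)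
    · have hn' : 0 < |(n : ℝ)| - 1 := by linarith
      have key : ∀ j : ℤ, |(n : ℝ)| - 1 ≤ |(j : ℝ)| →
          |normalizedCoeff η θ (m + 1) j| ≤ E / (|(n : ℝ)| - 1) := fun j hj => by
        rw [le_div_iff₀ hn', mul_comm]
        exact (mul_le_mul_of_nonneg_right hj (abs_nonneg _)).trans (hE η θ j h)
      have k1 := key (n - 1) (by
        push_cast
        have := abs_sub_abs_le_abs_sub (n : ℝ) 1
        rwa [abs_one] at this)
      have k2 := key (n + 1) (by
        push_cast
        have := abs_sub_abs_le_abs_sub (n : ℝ) (-1)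
        rwa [abs_neg, abs_one, sub_neg_eq_add] at this)
      have k3 := abs_mul_normalizedCoeff_le hη θ m n k1 k2
      calc _ ≤ (|(n : ℝ)| - 1) * (|(m : ℝ) + 1 / 2| / sinh η * (E / (|(n : ℝ)| - 1))) :=
            mul_le_mul_of_nonneg_left k3 hn'.le
        _ = |(m : ℝ) + 1 / 2| / sinh η * E := by
            field_simp
        _ ≤ _ := by gcongr
  have h3 : (n : ℝ) ^ 2 = |(n : ℝ)| * |(n : ℝ)| := by rw [abs_mul_abs_self, sq]
  rw [h3]
  linarith

theorem summable_one_div_int_sq_add_one : Summable fun n : ℤ => 1 / ((n : ℝ) ^ 2 + 1) := by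
  have h : Summable fun n : ℕ => 1 / ((n : ℝ) ^ 2 + 1) := by
    have h1 := ((summable_nat_add_iff 1).2
      (summable_one_div_nat_pow (p := 2).2 (by norm_num))).mul_left 2
    refine Summable.of_nonneg_of_le (fun n => by positivity) (fun n => ?_) h1
    rw [mul_one_div, div_le_div_iff₀ (by positivity) (by positivity)]
    push_cast
    nlinarith [sq_nonneg ((n : ℝ) - 1)]
  refine Summable.of_nat_of_neg (by simpa using h) (by simpa using h)

theorem summable_cosIntegral {η : ℝ} (hη : 0 < η) (m : ℤ) :
    Summable fun n : ℤ => cosIntegral (cosh η) (m + 1 / 2) n := by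
  obtain ⟨C, hC⟩ := exists_sq_normalizedCoeff_bound hη m
  have h : Summable fun n : ℤ => normalizedCoeff η 0 m n :=
    Summable.of_norm_bounded (summable_one_div_int_sq_add_one.mul_left C)
      fun n => hC η 0 n le_rfl
  have h1 := (sqrt_pos.2 (sub_cos_pos (one_lt_cosh.2 hη.ne') 0)).ne'
  have h2 := zpow_ne_zero m (sinh_pos_iff.2 hη).ne'
  exact (summable_mul_left_iff h2).1 ((summable_mul_left_iff h1).1 h)

/-! ### Fourier expansion of `(t - cos θ)^(-a)` -/

instance : Fact (0 < 2 * π) := ⟨two_pi_pos⟩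

/-- `(t - cos x)^(-a)` as a function on the circle. -/
def circlePower {t : ℝ} (ht : 1 < t) (a : ℝ) : C(AddCircle (2 * π), ℂ) where
  toFun x := (((t - Real.Angle.cos x) ^ (-a) : ℝ) : ℂ)
  continuous_toFun := by
    refine Complex.continuous_ofReal.comp
      ((continuous_const.sub Real.Angle.continuous_cos).rpow_const fun x => .inl ?_)
    induction x using Real.Angle.induction_on with
    | _ x =>
      change t - Real.Angle.cos x ≠ 0
      rw [Real.Angle.cos_coe]
      exact (sub_cos_pos ht x).ne'

theorem circlePower_coe {t : ℝ} (ht : 1 < t) (a x : ℝ) :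
    circlePower ht a (x : AddCircle (2 * π)) = (((t - cos x) ^ (-a) : ℝ) : ℂ) := rfl

theorem fourier_two_pi_coe (n : ℤ) (x : ℝ) :
    fourier n (x : AddCircle (2 * π)) = Complex.exp (n * x * Complex.I) := by
  rw [fourier_coe_apply]
  congr 1
  have : (π : ℂ) ≠ 0 := by exact_mod_cast pi_ne_zero
  push_cast
  field_simp

theorem fourierCoeff_circlePower {t : ℝ} (ht : 1 < t) (a : ℝ) (n : ℤ) :
    fourierCoeff (circlePower ht a) n = ((cosIntegral t a n / π : ℝ) : ℂ) := by
  rw [fourierCoeff_eq_intervalIntegral _ n (-π), show -π + 2 * π = π by ring]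
  simp only [fourier_two_pi_coe, circlePower_coe, smul_eq_mul]
  set g : ℝ → ℂ := fun x =>
    Complex.exp ((-n : ℤ) * x * Complex.I) * (((t - cos x) ^ (-a) : ℝ) : ℂ) with hg
  have hgc : Continuous g := by
    have := continuous_sub_cos_rpow ht (-a)
    fun_prop
  have h1 : ∫ x in (-π)..0, g x = ∫ x in (0 : ℝ)..π, g (-x) := by
    rw [intervalIntegral.integral_comp_neg, neg_zero]
  have h2 : ∀ x, g (-x) + g x = ((2 * (cos (n * x) * (t - cos x) ^ (-a)) : ℝ) : ℂ) := by
    intro x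
    simp only [hg, cos_neg]
    push_cast
    rw [← mul_assoc, Complex.two_cos]
    ring_nf
  have h3 : Continuous fun x => g (-x) := hgc.comp continuous_neg
  rw [← intervalIntegral.integral_add_adjacent_intervals (hgc.intervalIntegrable _ 0)
    (hgc.intervalIntegrable _ _), h1, ← intervalIntegral.integral_add
    (h3.intervalIntegrable _ _) (hgc.intervalIntegrable _ _)]
  simp only [h2]
  rw [intervalIntegral.integral_ofReal, intervalIntegral.integral_const_mul, Complex.real_smul,
    ← Complex.ofReal_mul, cosIntegral]
  congr 1
  field_simp

theorem hasSum_cosIntegral {t : ℝ} (ht : 1 < t) (a : ℝ)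
    (hs : Summable fun n : ℤ => cosIntegral t a n) (θ : ℝ) :
    HasSum (fun n : ℕ => (if n = 0 then 1 else 2) / π * cosIntegral t a n * cos (n * θ))
      ((t - cos θ) ^ (-a)) := by
  have hs' : Summable (fourierCoeff (circlePower ht a)) := by
    simp only [funext (fourierCoeff_circlePower ht a)]
    exact Complex.summable_ofReal.2 (hs.div_const π)
  have h := has_pointwise_sum_fourier_series_of_summable hs' (θ : AddCircle (2 * π))
  simp only [fourierCoeff_circlePower, fourier_two_pi_coe, circlePower_coe, smul_eq_mul] at h
  -- Pairing `n` with `-n` counts `n = 0` twice; the added term removes one copy.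
  have h1 := h.nat_add_neg.add (hasSum_ite_eq (0 : ℕ) (-((cosIntegral t a 0 / π : ℝ) : ℂ)))
  simp only [Int.cast_zero, zero_mul, Complex.exp_zero, mul_one, add_neg_cancel_right] at h1
  rw [← Complex.hasSum_ofReal]
  convert! h1 using 1
  ext n
  rw [cosIntegral_neg]
  split_ifs with hn
  · subst hn
    simp only [Nat.cast_zero, neg_zero, Int.cast_zero, zero_mul, Complex.exp_zero,
      mul_one, cos_zero, add_neg_cancel_right]
    push_cast
    ring
  · have := Complex.two_cos (n * θ)
    push_cast
    rw [add_zero, ← mul_add, show -(n : ℂ) * θ * Complex.I = -(n * θ) * Complex.I by ring, ← this]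
    ring

/-! ### Terms of the series and powers of `x₁ + i x₂` -/

theorem coeffJ_mul_interiorFormula (n : ℕ) (m : ℤ) (μ : ℤˣ) {x : EuclideanSpace ℝ (Fin 3)}
    (hx : 0 < eta x) :
    coeffJ n m μ * interiorFormula n m.natAbs 1 μ x =
      coeffSign m μ * ((if n = 0 then 1 else 2) / π) * normalizedCoeff (eta x) (theta x) m n *
        cos (n * theta x) * trig m.natAbs μ (phi x) := by
  have h := coeffJ_mul_legendreQ hx n m μ
  have ht : trig n 1 (theta x) = cos (n * theta x) := if_pos rfl
  rw [interiorFormula, normalizedCoeff, ht]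
  linear_combination √(cosh (eta x) - cos (theta x)) * cos (n * theta x) *
    trig m.natAbs μ (phi x) * h

theorem abs_trig_le_one (n : ℕ) (μ : ℤˣ) (θ : ℝ) : |trig n μ θ| ≤ 1 := by
  unfold trig
  split_ifs
  exacts [abs_cos_le_one _, abs_sin_le_one _]

theorem abs_coeffSign (m : ℤ) (μ : ℤˣ) : |coeffSign m μ| = 1 := by
  unfold coeffSign
  rcases Int.units_eq_one_or μ with rfl | rfl <;> split_ifs <;> simp

theorem trig_eq_exp (k : ℕ) (μ : ℤˣ) (φ : ℝ) :
    trig k μ φ = if μ = 1 then (Complex.exp (φ * Complex.I) ^ k).re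
      else (Complex.exp (φ * Complex.I) ^ k).im := by
  rw [← Complex.exp_nat_mul, ← mul_assoc, ← Complex.ofReal_natCast, ← Complex.ofReal_mul,
    Complex.exp_ofReal_mul_I_re, Complex.exp_ofReal_mul_I_im, trig]

theorem powerHarmonic_eq (m : ℤ) (μ : ℤˣ) {x : EuclideanSpace ℝ (Fin 3)} {r φ : ℝ}
    (h : (x 1 : ℂ) + (x 2 : ℂ) * Complex.I = r * Complex.exp (φ * Complex.I)) :
    powerHarmonic m μ x = coeffSign m μ * r ^ m * trig m.natAbs μ φ := by
  rw [powerHarmonic, h, mul_zpow, ← Complex.exp_int_mul, ← mul_assoc, ← Complex.ofReal_zpow,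
    ← Complex.ofReal_intCast, ← Complex.ofReal_mul, Complex.re_ofReal_mul, Complex.im_ofReal_mul,
    Complex.exp_ofReal_mul_I_re, Complex.exp_ofReal_mul_I_im, trig, coeffSign]
  obtain ⟨k, rfl | rfl⟩ := m.eq_nat_or_neg
  · simp only [Int.natAbs_natCast, Int.cast_natCast, Nat.cast_nonneg, if_true, one_mul]
    split_ifs <;> rfl
  -- `m = -0` lands in this branch but has sign `1`. For `k > 0` the sign `μ` comes from `sin` being
  -- odd and `cos` even.
  · rcases k.eq_zero_or_pos with rfl | hk
    · simp
    · rw [if_neg (by omega : ¬ (0 : ℤ) ≤ -k)]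
      rcases Int.units_eq_one_or μ with rfl | rfl <;> simp

theorem exp_phi (x : EuclideanSpace ℝ (Fin 3)) :
    (x 1 : ℂ) + (x 2 : ℂ) * Complex.I =
      ‖(⟨x 1, x 2⟩ : ℂ)‖ * Complex.exp (phi x * Complex.I) := by
  rw [phi, Complex.norm_mul_exp_arg_mul_I]
  exact Complex.mk_eq_add_mul_I _ _ ▸ rfl

/-! ### Behaviour at the limiting circle -/

theorem norm_eq_one_of_mem_limitCircle {x : EuclideanSpace ℝ (Fin 3)} (hx : x ∈ limitCircle) :
    ‖(⟨x 1, x 2⟩ : ℂ)‖ = 1 := by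
  rw [Complex.norm_def, Complex.normSq_mk, ← sq, ← sq, hx.2, sqrt_one]

/-- The angle `phi` jumps across the branch cut, but `cos kφ` and `sin kφ` are the real and
imaginary parts of `(z / |z|)^k`, continuous where `z ≠ 0`. -/
theorem continuousAt_trig_phi (k : ℕ) (μ : ℤˣ) {x : EuclideanSpace ℝ (Fin 3)}
    (hx : x ∈ limitCircle) : ContinuousAt (fun y => trig k μ (phi y)) x := by
  have hz : Continuous fun y : EuclideanSpace ℝ (Fin 3) => (⟨y 1, y 2⟩ : ℂ) := by
    simp only [Complex.mk_eq_add_mul_I]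
    fun_prop
  have hne : ‖(⟨x 1, x 2⟩ : ℂ)‖ ≠ 0 := by
    rw [norm_eq_one_of_mem_limitCircle hx]
    exact one_ne_zero
  have hc : ContinuousAt (fun y : EuclideanSpace ℝ (Fin 3) =>
      ((⟨y 1, y 2⟩ : ℂ) / (‖(⟨y 1, y 2⟩ : ℂ)‖ : ℂ)) ^ k) x :=
    (hz.continuousAt.div (Complex.continuous_ofReal.comp hz.norm).continuousAt
      (Complex.ofReal_ne_zero.2 hne)).pow k
  have hev : ∀ᶠ y : EuclideanSpace ℝ (Fin 3) in 𝓝 x,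
      Complex.exp (phi y * Complex.I) = (⟨y 1, y 2⟩ : ℂ) / (‖(⟨y 1, y 2⟩ : ℂ)‖ : ℂ) := by
    filter_upwards [hz.norm.continuousAt.eventually_ne hne] with y hy
    rw [eq_div_iff (by exact_mod_cast hy), mul_comm, ← exp_phi, Complex.mk_eq_add_mul_I]
  simp only [trig_eq_exp]
  split_ifs
  · refine (Complex.continuous_re.continuousAt.comp hc).congr ?_
    filter_upwards [hev] with y hy
    rw [hy]
    rfl
  · refine (Complex.continuous_im.continuousAt.comp hc).congr ?_
    filter_upwards [hev] with y hy
    rw [hy]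
    rfl

theorem tendsto_eta {x : EuclideanSpace ℝ (Fin 3)} (hx : x ∈ limitCircle) :
    Tendsto eta (𝓝[limitCircleᶜ] x) atTop := by
  have hc : Continuous fun y : EuclideanSpace ℝ (Fin 3) =>
      2 * √(y 1 ^ 2 + y 2 ^ 2) / (y 0 ^ 2 + y 1 ^ 2 + y 2 ^ 2 + 1) :=
    Continuous.div (by fun_prop) (by fun_prop) fun y => by positivity
  have hval : 2 * √(x 1 ^ 2 + x 2 ^ 2) / (x 0 ^ 2 + x 1 ^ 2 + x 2 ^ 2 + 1) = 1 := by
    rw [add_assoc (x 0 ^ 2), hx.1, hx.2, sqrt_one]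
    norm_num
  rw [tendsto_atTop]
  intro M
  have hM : tanh M < 1 := tanh_lt_one M
  have hev := (hc.tendsto x).eventually_const_lt (hval ▸ hM)
  filter_upwards [nhdsWithin_le_nhds hev, self_mem_nhdsWithin] with y hy hyc
  rw [← artanh_tanh M, eta]
  refine (artanh_lt_artanh (neg_one_lt_tanh M) ?_ hy).le
  rw [div_lt_one (by positivity)]
  -- Since `x₀² + ρ² + 1 - 2ρ = x₀² + (ρ - 1)²`, the quotient reaches `1` only on the circle.
  by_contra! hle
  have hsq : √(y 1 ^ 2 + y 2 ^ 2) ^ 2 = y 1 ^ 2 + y 2 ^ 2 := sq_sqrt (by positivity)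
  set ρ := √(y 1 ^ 2 + y 2 ^ 2)
  have h0 : y 0 = 0 := by nlinarith [sq_nonneg (ρ - 1), sq_nonneg (y 0)]
  have h1 : ρ = 1 := by nlinarith [sq_nonneg (ρ - 1), sq_nonneg (y 0)]
  exact hyc ⟨h0, by rw [← hsq, h1, one_pow]⟩

theorem nhdsWithin_compl_limitCircle_neBot {x : EuclideanSpace ℝ (Fin 3)} (hx : x ∈ limitCircle) :
    (𝓝[limitCircleᶜ] x).NeBot := by
  rw [← mem_closure_iff_nhdsWithin_neBot]
  have hc : Continuous fun ε : ℝ => x + ε • EuclideanSpace.single (0 : Fin 3) (1 : ℝ) := by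
    fun_prop
  have ht : Tendsto (fun ε : ℝ => x + ε • EuclideanSpace.single (0 : Fin 3) (1 : ℝ))
      (𝓝[≠] 0) (𝓝 x) := by
    have := hc.tendsto 0
    rw [zero_smul, add_zero] at this
    exact this.mono_left nhdsWithin_le_nhds
  refine mem_closure_of_tendsto ht ?_
  filter_upwards [self_mem_nhdsWithin] with ε hε hmem
  have h0 := hmem.1
  simp [hx.1] at h0
  exact hε h0

/-- The angle `f` is arbitrary because `θ` has no limit at the circle and the bounds are uniform in
it. For `n = 0` two bounds squeeze to `π`; otherwise the factor `1 / sinh η` forces the limit `0`.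
-/
theorem tendsto_normalizedCoeff {α : Type*} {l : Filter α} {e : α → ℝ} (he : Tendsto e l atTop)
    (f : α → ℝ) (m : ℤ) (n : ℕ) :
    Tendsto (fun y => normalizedCoeff (e y) (f y) m n) l (𝓝 (if n = 0 then π else 0)) := by
  have hpos := he.eventually_gt_atTop 0
  have hB : ∀ k : ℕ, Tendsto (fun y => cothHalf (e y) ^ k) l (𝓝 1) := fun k => by
    simpa using (tendsto_cothHalf.comp he).pow k
  split_ifs with hn
  · subst hn
    have h1 : Tendsto (fun y => (cothHalf (e y) ^ (m.natAbs + 1))⁻¹ * π) l (𝓝 π) := by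
      simpa using ((hB (m.natAbs + 1)).inv₀ one_ne_zero).mul_const π
    have h2 : Tendsto (fun y => cothHalf (e y) ^ (m.natAbs + 1) * π) l (𝓝 π) := by
      simpa using (hB (m.natAbs + 1)).mul_const π
    refine tendsto_of_tendsto_of_tendsto_of_le_of_le' h1 h2 ?_ ?_
    · filter_upwards [hpos] with y hy using normalizedCoeff_zero_ge hy _ _
    · filter_upwards [hpos] with y hy using
        (le_abs_self _).trans (abs_normalizedCoeff_le hy _ _ _)
  · have hs : Tendsto (fun y => sinh (e y)) l atTop := by
      refine tendsto_atTop_mono' _ ?_ he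
      filter_upwards [hpos] with y hy using self_le_sinh_iff.2 hy.le
    have h := (tendsto_const_nhds (x := |(m : ℝ) + 1 / 2|)).div_atTop hs |>.mul
      ((hB ((m + 1).natAbs + 1)).mul_const π)
    rw [zero_mul] at h
    refine squeeze_zero_norm' ?_ h
    filter_upwards [hpos] with y hy
    have h1 := abs_mul_normalizedCoeff_le hy (f y) m n (abs_normalizedCoeff_le hy _ _ _)
      (abs_normalizedCoeff_le hy _ _ _)
    refine le_trans ?_ h1
    rw [norm_eq_abs]
    refine le_mul_of_one_le_left (abs_nonneg _) ?_
    rw [Int.cast_natCast, Nat.abs_cast]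
    exact_mod_cast Nat.one_le_iff_ne_zero.2 hn

theorem tendsto_coeffJ_mul_interiorFormula (n : ℕ) (m : ℤ) (μ : ℤˣ)
    {x : EuclideanSpace ℝ (Fin 3)} (hx : x ∈ limitCircle) :
    Tendsto (fun y => coeffJ n m μ * interiorFormula n m.natAbs 1 μ y) (𝓝[limitCircleᶜ] x)
      (𝓝 (if n = 0 then coeffSign m μ * trig m.natAbs μ (phi x) else 0)) := by
  have he := tendsto_eta hx
  have hH := tendsto_normalizedCoeff he theta m n
  have hφ : Tendsto (fun y => trig m.natAbs μ (phi y)) (𝓝[limitCircleᶜ] x)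
      (𝓝 (trig m.natAbs μ (phi x))) :=
    (continuousAt_trig_phi m.natAbs μ hx).tendsto.mono_left nhdsWithin_le_nhds
  have hcong : (fun y => coeffSign m μ * ((if n = 0 then 1 else 2) / π) *
      normalizedCoeff (eta y) (theta y) m n * cos (n * theta y) * trig m.natAbs μ (phi y))
      =ᶠ[𝓝[limitCircleᶜ] x] fun y => coeffJ n m μ * interiorFormula n m.natAbs 1 μ y := by
    filter_upwards [he.eventually_gt_atTop 0] with y hy
      using (coeffJ_mul_interiorFormula n m μ hy).symm
  refine Tendsto.congr' hcong ?_
  split_ifs at hH ⊢ with hn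
  · subst hn
    simp only [Nat.cast_zero, zero_mul, cos_zero, mul_one]
    convert! (hH.const_mul (coeffSign m μ * (1 / π))).mul hφ using 2
    field_simp
  · refine squeeze_zero_norm (fun y => ?_)
      (by simpa using hH.norm.const_mul (|coeffSign m μ * (2 / π)|))
    rw [norm_mul, norm_mul, norm_mul]
    calc _ ≤ ‖coeffSign m μ * (2 / π)‖ * ‖normalizedCoeff (eta y) (theta y) m n‖ * 1 * 1 := by
          gcongr
          exacts [abs_cos_le_one _, abs_trig_le_one _ _ _]
      _ = _ := by simp only [mul_one, norm_eq_abs, abs_mul]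

theorem coeffJ_mul_interiorHarmonic_of_mem (n : ℕ) (m : ℤ) (μ : ℤˣ)
    {x : EuclideanSpace ℝ (Fin 3)} (hx : x ∈ limitCircle) :
    coeffJ n m μ * interiorHarmonic n m.natAbs 1 μ x =
      if n = 0 then coeffSign m μ * trig m.natAbs μ (phi x) else 0 := by
  have := nhdsWithin_compl_limitCircle_neBot hx
  have h := (tendsto_coeffJ_mul_interiorFormula n m μ hx).const_mul (coeffJ n m μ)⁻¹
  simp only [inv_mul_cancel_left₀ (coeffJ_ne_zero n m μ)] at h
  rw [interiorHarmonic, if_pos hx, h.limUnder_eq, mul_inv_cancel_left₀ (coeffJ_ne_zero n m μ)]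

/-! ### The pointwise sum and the uniform majorant -/

theorem point_notMem_limitCircle {η : ℝ} (hη : 0 < η) (θ φ : ℝ) :
    point η θ φ ∉ limitCircle := by
  rintro ⟨h0, h1⟩
  have hd := denom_pos hη θ
  have h := normSq_point hη θ φ
  rw [add_assoc, h0, h1, eq_div_iff hd.ne'] at h
  have hs : sin θ = 0 := by
    have : sin θ / (cosh η - cos θ) = 0 := h0
    exact (div_eq_zero_iff.1 this).resolve_right hd.ne'
  have hc : cos θ = 0 := by linarith
  have := sin_sq_add_cos_sq θ
  rw [hs, hc] at this
  norm_num at this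

theorem exists_point_of_mem_solidTorus {η₀ : ℝ} {x : EuclideanSpace ℝ (Fin 3)}
    (hx : x ∈ solidTorus η₀) (hxc : x ∉ limitCircle) : ∃ η θ φ : ℝ, 0 < η ∧ η₀ < η ∧
      θ ∈ Set.Ioc (-π) π ∧ φ ∈ Set.Ioc (-π) π ∧ x = point η θ φ := by
  obtain ⟨η, θ, φ, h0, h1, h2, h3, rfl⟩ := hx.resolve_right hxc
  -- `theta` takes values in `(-π, π]`, so `θ = -π` is replaced by `π`, which gives the same point.
  rcases h2.1.eq_or_lt with rfl | h
  · refine ⟨η, π, φ, h0, h1, ⟨by linarith [pi_pos], le_rfl⟩, h3, ?_⟩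
    simp [point]
  · exact ⟨η, θ, φ, h0, h1, ⟨h, h2.2⟩, h3, rfl⟩

theorem coeffJ_mul_interiorHarmonic_point (n : ℕ) (m : ℤ) (μ : ℤˣ) {η θ φ : ℝ} (hη : 0 < η)
    (hθ : θ ∈ Set.Ioc (-π) π) (hφ : φ ∈ Set.Ioc (-π) π) :
    coeffJ n m μ * interiorHarmonic n m.natAbs 1 μ (point η θ φ) =
      coeffSign m μ * ((if n = 0 then 1 else 2) / π) * normalizedCoeff η θ m n *
        cos (n * θ) * trig m.natAbs μ φ := by
  rw [interiorHarmonic, if_neg (point_notMem_limitCircle hη θ φ),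
    coeffJ_mul_interiorFormula n m μ (by rwa [eta_point hη]), eta_point hη, theta_point hη hθ,
    phi_point hη θ hφ]

theorem hasSum_point (m : ℤ) (μ : ℤˣ) {η θ φ : ℝ} (hη : 0 < η)
    (hθ : θ ∈ Set.Ioc (-π) π) (hφ : φ ∈ Set.Ioc (-π) π) :
    HasSum (fun n : ℕ => coeffJ n m μ * interiorHarmonic n m.natAbs 1 μ (point η θ φ))
      (powerHarmonic m μ (point η θ φ)) := by
  have ht := one_lt_cosh.2 hη.ne'
  have hd := denom_pos hη θ
  have h := (hasSum_cosIntegral ht (m + 1 / 2) (summable_cosIntegral hη m) θ).mul_left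
    (coeffSign m μ * √(cosh η - cos θ) * sinh η ^ m * trig m.natAbs μ φ)
  have hz : ((point η θ φ 1 : ℝ) : ℂ) + ((point η θ φ 2 : ℝ) : ℂ) * Complex.I =
      ((sinh η / (cosh η - cos θ) : ℝ) : ℂ) * Complex.exp (φ * Complex.I) := by
    rw [Complex.exp_mul_I, ← Complex.ofReal_cos, ← Complex.ofReal_sin]
    simp only [point, PiLp.toLp_apply, Matrix.cons_val]
    push_cast
    ring
  have hr : √(cosh η - cos θ) * (cosh η - cos θ) ^ (-((m : ℝ) + 1 / 2)) =
      ((cosh η - cos θ) ^ m)⁻¹ := by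
    rw [sqrt_eq_rpow, ← rpow_add hd, ← rpow_intCast, ← rpow_neg hd.le]
    ring_nf
  rw [powerHarmonic_eq m μ hz, div_zpow, div_eq_mul_inv, ← hr]
  convert! h using 1
  · ext n
    rw [coeffJ_mul_interiorHarmonic_point n m μ hη hθ hφ, normalizedCoeff]
    ring
  · ring

theorem hasSum_interiorHarmonic {η₀ : ℝ} (m : ℤ) (μ : ℤˣ) {x : EuclideanSpace ℝ (Fin 3)}
    (hx : x ∈ solidTorus η₀) :
    HasSum (fun n : ℕ => coeffJ n m μ * interiorHarmonic n m.natAbs 1 μ x)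
      (powerHarmonic m μ x) := by
  by_cases hxc : x ∈ limitCircle
  · simp only [coeffJ_mul_interiorHarmonic_of_mem _ m μ hxc]
    rw [powerHarmonic_eq m μ (exp_phi x), norm_eq_one_of_mem_limitCircle hxc, one_zpow, mul_one]
    exact hasSum_ite_eq 0 _
  · obtain ⟨η, θ, φ, h0, -, h2, h3, rfl⟩ := exists_point_of_mem_solidTorus hx hxc
    exact hasSum_point m μ h0 h2 h3

theorem exists_summable_bound {η₀ : ℝ} (hη₀ : 0 < η₀) (m : ℤ) (μ : ℤˣ) :
    ∃ u : ℕ → ℝ, Summable u ∧ ∀ n, ∀ x ∈ solidTorus η₀,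
      ‖coeffJ n m μ * interiorHarmonic n m.natAbs 1 μ x‖ ≤ u n := by
  obtain ⟨C, hC⟩ := exists_sq_normalizedCoeff_bound hη₀ m
  have hC0 : 0 ≤ C := by
    have := (abs_nonneg _).trans (hC η₀ 0 0 le_rfl)
    simpa using this
  -- The extra `1` at `n = 0` covers the limiting circle, where that term is bounded by `1` and the
  -- others vanish.
  refine ⟨fun n => 2 / π * (C * (1 / ((n : ℝ) ^ 2 + 1))) + if n = 0 then 1 else 0, ?_, ?_⟩
  · refine Summable.add (Summable.mul_left _ (Summable.mul_left _ ?_)) (hasSum_ite_eq 0 _).summable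
    simpa using! summable_one_div_int_sq_add_one.comp_injective Nat.cast_injective
  · intro n x hx
    by_cases hxc : x ∈ limitCircle
    · rw [coeffJ_mul_interiorHarmonic_of_mem n m μ hxc]
      refine le_add_of_nonneg_of_le (by positivity) ?_
      split_ifs
      · rw [norm_mul, norm_eq_abs, abs_coeffSign, one_mul]
        exact abs_trig_le_one _ _ _
      · simp
    · obtain ⟨η, θ, φ, h0, h1, h2, h3, rfl⟩ := exists_point_of_mem_solidTorus hx hxc
      rw [coeffJ_mul_interiorHarmonic_point n m μ h0 h2 h3]
      refine le_add_of_le_of_nonneg ?_ (by split_ifs <;> norm_num)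
      rw [norm_mul, norm_mul, norm_mul, norm_mul, norm_eq_abs, abs_coeffSign, one_mul]
      have e1 : ‖(if n = 0 then (1 : ℝ) else 2) / π‖ ≤ 2 / π := by
        rw [norm_div, norm_of_nonneg pi_pos.le]
        gcongr
        split_ifs <;> norm_num
      have e2 := hC η θ n h1.le
      rw [Int.cast_natCast] at e2
      calc _ ≤ 2 / π * (C * (1 / ((n : ℝ) ^ 2 + 1))) * 1 * 1 := by
            gcongr
            exacts [e2, abs_cos_le_one _, abs_trig_le_one _ _ _]
        _ = _ := by ring

end Toroidal

end

theorem mainTheorem8 (η₀ : ℝ) (hη₀ : 0 < η₀) (m : ℤ) (μ : ℤˣ) :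
    HasSumUniformlyOn
      (fun (n : ℕ) (x : EuclideanSpace ℝ (Fin 3)) =>
        Toroidal.coeffJ n m μ * Toroidal.interiorHarmonic n m.natAbs 1 μ x)
      (Toroidal.powerHarmonic m μ) (Toroidal.solidTorus η₀) := by
  obtain ⟨u, hu, hb⟩ := Toroidal.exists_summable_bound hη₀ m μ
  -- The M-test gives uniform convergence to the pointwise sum, which the pointwise expansion
  -- identifies.
  exact (HasSumUniformlyOn.of_norm_le_summable hu hb).congr_right
    fun x hx => (Toroidal.hasSum_interiorHarmonic m μ hx).tsum_eq
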